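/- Let $K$ be an arbitrary field and let $R=K[x,y,z]$ act on $R'=K[X,Y,Z]$ by contraction: $x^iy^jz^k\circ X^uY^vZ^w = X^{u-i}Y^{v-j}Z^{w-k}$ if $i\le u$, $j\le v$, $k\le w$, and $x^iy^jz^k\circ X^uY^vZ^w=0$ otherwise, extended $K$-bilinearly. For $F\in R'$ put $\operatorname{Ann}(F)=\{f\in R : f\circ F=0\}$, an ideal of $R$, and $A_F=R/\operatorname{Ann}(F)$. The algebra $A_F$ is called a complete intersection if $\operatorname{Ann}(F)$ is generated by a regular sequence in $R$. Let $a,b,c,e,m\ge 0$ be integers with $n=e+m>0$, let $$F=X^aY^bZ^c\,(Z^n-X^eY^m)=X^aY^bZ^{c+n}-X^{a+e}Y^{b+m}Z^c,$$ and let $q=\left\lfloor \frac{c+1}{n}\right\rfloor$. Then $A_F$ is a complete intersection if and only if $e=0$, or $m=0$, or $a<qe$, or $b<qm$. -/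

import Mathlib

namespace MacaulayDuality

open MvPolynomial

variable {σ K : Type*} [Field K]

/-- The contraction action `f ∘ F` of the polynomial ring `R = K[x_i]` on `R' = K[X_i]`.
A monomial `x^u` sends `X^v` to `X^(v - u)` if `u ≤ v` and to `0` otherwise
(this is `MvPolynomial.divMonomial`), and the action is extended `K`-bilinearly.
Here `X^v` plays the role of the divided power monomial of exponent `v`. -/
noncomputable def contract (f F : MvPolynomial σ K) : MvPolynomial σ K :=
  ∑ u ∈ f.support, coeff u f • F.divMonomial u

theorem contract_eq_sum (f F : MvPolynomial σ K) (s : Finset (σ →₀ ℕ)) (hs : f.support ⊆ s) :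
    contract f F = ∑ u ∈ s, coeff u f • F.divMonomial u := by
  refine Finset.sum_subset hs fun u _ hu => ?_
  rw [notMem_support_iff.mp hu, zero_smul]

@[simp]
theorem contract_zero_left (F : MvPolynomial σ K) : contract 0 F = 0 := by
  simp [contract]

@[simp]
theorem contract_zero_right (f : MvPolynomial σ K) : contract f 0 = 0 := by
  simp [contract]

theorem contract_add_left (f g F : MvPolynomial σ K) :
    contract (f + g) F = contract f F + contract g F := by
  classical
  rw [contract_eq_sum (f + g) F _ support_add,
    contract_eq_sum f F (f.support ∪ g.support) Finset.subset_union_left,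
    contract_eq_sum g F (f.support ∪ g.support) Finset.subset_union_right,
    ← Finset.sum_add_distrib]
  simp only [coeff_add, add_smul]

theorem contract_add_right (f F G : MvPolynomial σ K) :
    contract f (F + G) = contract f F + contract f G := by
  simp only [contract, add_divMonomial, smul_add, Finset.sum_add_distrib]

theorem contract_monomial_left (u : σ →₀ ℕ) (r : K) (F : MvPolynomial σ K) :
    contract (monomial u r) F = r • F.divMonomial u := by
  classical
  rw [contract_eq_sum _ F {u} support_monomial_subset]
  simp

/-- The contraction action makes `R'` an `R`-module: `(f g) ∘ F = f ∘ (g ∘ F)`. -/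
theorem contract_mul (f g F : MvPolynomial σ K) :
    contract (f * g) F = contract f (contract g F) := by
  induction f using MvPolynomial.induction_on' with
  | add p q hp hq => rw [add_mul, contract_add_left, contract_add_left, hp, hq]
  | monomial u r =>
    induction g using MvPolynomial.induction_on' with
    | add p q hp hq =>
      rw [mul_add, contract_add_left, contract_add_left, contract_add_right, hp, hq]
    | monomial v s =>
      rw [monomial_mul, contract_monomial_left, contract_monomial_left, contract_monomial_left]
      ext w
      simp only [coeff_smul, coeff_divMonomial, smul_eq_mul, mul_assoc]
      rw [show u + v + w = v + (u + w) by abel]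

/-- The annihilator `Ann(F) = {f ∈ R | f ∘ F = 0}`, an ideal of `R`. The algebra `A_F` with
Macaulay dual generator `F` is the quotient `R ⧸ Ann(F)`. -/
noncomputable def Ann (F : MvPolynomial σ K) : Ideal (MvPolynomial σ K) where
  carrier := {f | contract f F = 0}
  add_mem' {f g} hf hg := by
    simp only [Set.mem_ofPred_eq] at hf hg ⊢
    rw [contract_add_left, hf, hg, add_zero]
  zero_mem' := contract_zero_left F
  smul_mem' g f hf := by
    simp only [Set.mem_ofPred_eq] at hf ⊢
    rw [smul_eq_mul, contract_mul, hf, contract_zero_right]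

/-- The algebra `A_F = R ⧸ Ann(F)` is a complete intersection: the ideal `Ann(F)` is generated by
a regular sequence of elements of the polynomial ring `R`. -/
def IsCompleteIntersection (F : MvPolynomial σ K) : Prop :=
  ∃ rs : List (MvPolynomial σ K),
    RingTheory.Sequence.IsRegular (MvPolynomial σ K) rs ∧ Ideal.ofList rs = Ann F

end MacaulayDuality

open MvPolynomial

/-! Write s = x^e y^m and t = z^n. Contracting the monomial X^(a+e) Y^(b+m) Z^(c+n) by t - s gives
-F, so Ann(F) is the colon ideal (x^(a+e+1), y^(b+m+1), z^(c+n+1)) : (t - s) (`mem_Ann_binomial`).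
The geometric sum g_q = ∑ t^l s^(q-l), with (t - s) g_q = t^(q+1) - s^(q+1), makes this colon
explicit.

If a < qe, then s^(q+1) vanishes mod x^(a+e+1), so z^(c+n+1) becomes a multiple of t - s, which
cancels and leaves three generators; b < qm is symmetric. If e = 0 or m = 0, the same argument with
y or z in the role of x leaves one balanced case, where two consecutive geometric sums appear as
generators.

Otherwise Ann(F) has four independent minimal generators: the powers of x and y, x^(a-qe+1)
z^(c+1-qn) g_q, and an element containing the least pure power of z. A regular sequence in K[x,y,z]
has length at most 3. -/

/-! ### Regular sequences, colon ideals and geometric sums -/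

theorem RingTheory.Sequence.IsRegular.length_le_ringKrullDim {R : Type*} [CommRing R]
    (rs : List R) (h : RingTheory.Sequence.IsRegular R rs) :
    (rs.length : WithBot ℕ∞) ≤ ringKrullDim R := by
  induction hn : rs.length generalizing R with
  | zero =>
    have : Nontrivial R := h.nontrivial
    exact_mod_cast ringKrullDim_nonneg_of_nontrivial
  | succ n ih =>
    match rs, hn with
    | r :: rs, hn =>
      -- Dividing by the first term, a nonzerodivisor, lowers the dimension by at least one.
      rw [RingTheory.Sequence.isRegular_cons_iff] at h
      obtain ⟨hr, h⟩ := h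
      let e : QuotSMulTop r R ≃ₗ[R] R ⧸ Ideal.span {r} :=
        Submodule.quotEquivOfEq _ _ (by
          rw [← Submodule.ideal_span_singleton_smul, smul_eq_mul, Ideal.mul_top])
      have h' : RingTheory.Sequence.IsRegular (R ⧸ Ideal.span {r})
          (rs.map (Ideal.Quotient.mk (Ideal.span {r}))) := by
        refine (AddEquiv.isRegular_congr (e := e.toAddEquiv) ?_).mp h
        exact List.forall₂_map_right_iff.mpr <| List.forall₂_same.mpr fun s _ x =>
          e.map_smul s x
      have h1 := ih _ h' (by simpa using hn)
      have hr' : r ∈ nonZeroDivisors R := by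
        rw [mem_nonZeroDivisors_iff_right]
        intro x hx
        exact hr (show r • x = r • 0 by simpa [mul_comm] using hx)
      calc ((n + 1 : ℕ) : WithBot ℕ∞) = n + 1 := by push_cast; rfl
        _ ≤ ringKrullDim (R ⧸ Ideal.span {r}) + 1 := by gcongr
        _ ≤ _ := ringKrullDim_quotient_succ_le_of_nonZeroDivisor hr'

/-- If `p, u` and `p, u, v` are regular, then `u` is regular modulo `(p, v)`. -/
theorem Ideal.mem_span_pair_of_mul_mem_of_swap {R : Type*} [CommRing R] {p u v : R}
    (hu : ∀ f, p ∣ u * f → p ∣ f)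
    (hv : ∀ f, v * f ∈ Ideal.span {p, u} → f ∈ Ideal.span {p, u}) (f : R)
    (hf : u * f ∈ Ideal.span {p, v}) : f ∈ Ideal.span {p, v} := by
  obtain ⟨α, β, h⟩ := Ideal.mem_span_pair.mp hf
  -- From u f = α p + β v, regularity of v gives β = γ p + δ u; then p divides u (f - v δ).
  obtain ⟨γ, δ, h'⟩ := Ideal.mem_span_pair.mp
    (hv β (Ideal.mem_span_pair.mpr ⟨-α, f, by linear_combination -h⟩))
  obtain ⟨ε, h''⟩ := hu (f - v * δ) ⟨α + γ * v, by linear_combination -h - v * h'⟩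
  exact Ideal.mem_span_pair.mpr ⟨ε, δ, by linear_combination -h''⟩

/-- Colon step: a factor `u` of one generator can be cancelled. -/
theorem Ideal.mem_span_triple_of_mul_mem {R : Type*} [CommRing R] {p u v g : R}
    (hu : ∀ f, u * f ∈ Ideal.span {p, v} → f ∈ Ideal.span {p, v}) (f : R)
    (hf : u * f ∈ Ideal.span {p, v, u * g}) : f ∈ Ideal.span {p, v, g} := by
  obtain ⟨α, β, γ, h⟩ := Submodule.mem_span_triple.mp hf
  simp only [smul_eq_mul] at h
  obtain ⟨s, t, h'⟩ := Ideal.mem_span_pair.mp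
    (hu (f - γ * g) (Ideal.mem_span_pair.mpr ⟨α, β, by linear_combination h⟩))
  exact Submodule.mem_span_triple.mpr ⟨s, t, γ, by
    simp only [smul_eq_mul]; linear_combination h'⟩

theorem mul_geom_sum₂_succ {R : Type*} [CommRing R] (s t : R) (q : ℕ) :
    (t - s) * ∑ l ∈ Finset.range (q + 1), t ^ l * s ^ (q - l) = t ^ (q + 1) - s ^ (q + 1) := by
  have := (Commute.all t s).mul_geom_sum₂ (q + 1)
  simpa using this

theorem geom_sum₂_succ {R : Type*} [CommRing R] (s t : R) (q : ℕ) :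
    ∑ l ∈ Finset.range (q + 2), t ^ l * s ^ (q + 1 - l) =
      t ^ (q + 1) + s * ∑ l ∈ Finset.range (q + 1), t ^ l * s ^ (q - l) := by
  rw [Finset.sum_range_succ, Finset.mul_sum, add_comm]
  congr 1
  · simp
  · refine Finset.sum_congr rfl fun l hl => ?_
    rw [Nat.succ_sub (by simpa [Nat.lt_succ_iff] using hl), pow_succ]
    ring

theorem geom_sum₂_symm {R : Type*} [CommRing R] (s t : R) (q : ℕ) :
    ∑ l ∈ Finset.range (q + 1), t ^ l * s ^ (q - l) =
      ∑ l ∈ Finset.range (q + 1), s ^ l * t ^ (q - l) := by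
  simpa using (Commute.all t s).geom_sum₂_comm (q + 1)

/-! ### Annihilators under contraction and ideals of powers of variables -/

namespace MacaulayDuality

variable {σ K : Type*} [Field K]

theorem mem_Ann {f F : MvPolynomial σ K} : f ∈ Ann F ↔ contract f F = 0 := Iff.rfl

theorem contract_one_left (F : MvPolynomial σ K) : contract 1 F = F := by
  rw [← C_1, C_apply, contract_monomial_left, divMonomial_zero, one_smul]

theorem contract_neg_right (f F : MvPolynomial σ K) : contract f (-F) = - contract f F := by
  rw [eq_neg_iff_add_eq_zero, ← contract_add_right]
  simp

theorem contract_sub_left (f g F : MvPolynomial σ K) :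
    contract (f - g) F = contract f F - contract g F := by
  rw [eq_sub_iff_add_eq, ← contract_add_left, sub_add_cancel]

theorem Ann_neg (F : MvPolynomial σ K) : Ann (-F) = Ann F := by
  ext f
  rw [mem_Ann, mem_Ann, contract_neg_right, neg_eq_zero]

theorem isCompleteIntersection_neg {F : MvPolynomial σ K} :
    IsCompleteIntersection (-F) ↔ IsCompleteIntersection F := by
  rw [IsCompleteIntersection, Ann_neg, IsCompleteIntersection]

theorem contract_monomial_mul (v : σ →₀ ℕ) (F : MvPolynomial σ K) :
    contract (monomial v 1) (monomial v 1 * F) = F := by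
  rw [contract_monomial_left, one_smul, divMonomial_monomial_mul]

theorem mem_Ann_contract {u f F : MvPolynomial σ K} :
    f ∈ Ann (contract u F) ↔ u * f ∈ Ann F := by
  rw [mem_Ann, mem_Ann, mul_comm, contract_mul]

theorem mem_Ann_monomial {v : σ →₀ ℕ} {f : MvPolynomial σ K} :
    f ∈ Ann (monomial v 1) ↔ ∀ w ∈ f.support, ¬ w ≤ v := by
  classical
  have key (u : σ →₀ ℕ) : coeff u (contract f (monomial v 1)) =
      ∑ w ∈ f.support, if v = w + u then coeff w f else 0 := by
    simp [contract, coeff_sum, coeff_divMonomial, coeff_monomial]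
  rw [mem_Ann]
  constructor
  · intro h w hw hwv
    have h1 := key (v - w)
    rw [h, coeff_zero, Finset.sum_eq_single w] at h1
    · rw [if_pos (add_tsub_cancel_of_le hwv).symm] at h1
      exact mem_support_iff.mp hw h1.symm
    · intro w' _ hne
      refine if_neg fun h2 => hne ?_
      exact (add_right_cancel (h2.symm.trans (add_tsub_cancel_of_le hwv).symm))
    · exact fun h2 => absurd hw h2
  · intro h
    ext u
    rw [key, coeff_zero]
    refine Finset.sum_eq_zero fun w hw => if_neg ?_
    rintro rfl
    exact h w hw le_self_add

theorem mem_span_X_pow_pair {i j : σ} {A B : ℕ} {f : MvPolynomial σ K} :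
    f ∈ Ideal.span {X i ^ A, X j ^ B} ↔ ∀ w ∈ f.support, A ≤ w i ∨ B ≤ w j := by
  have := mem_ideal_span_monomial_image (x := f) (s := {Finsupp.single i A, Finsupp.single j B})
  simpa [Set.image_insert_eq, ← X_pow_eq_monomial] using this

theorem mem_span_X_pow_triple {i j k : σ} {A B C : ℕ} {f : MvPolynomial σ K} :
    f ∈ Ideal.span {X i ^ A, X j ^ B, X k ^ C} ↔
      ∀ w ∈ f.support, A ≤ w i ∨ B ≤ w j ∨ C ≤ w k := by
  have := mem_ideal_span_monomial_image (x := f)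
    (s := {Finsupp.single i A, Finsupp.single j B, Finsupp.single k C})
  simpa [Set.image_insert_eq, ← X_pow_eq_monomial] using this

theorem mem_span_X_pow_pair_of_X_pow_mul_mem {i j k : σ} (hik : i ≠ k) (hjk : j ≠ k) {A B M : ℕ}
    (f : MvPolynomial σ K) (hf : X k ^ M * f ∈ Ideal.span {X i ^ A, X j ^ B}) :
    f ∈ Ideal.span {X i ^ A, X j ^ B} := by
  rw [mem_span_X_pow_pair] at hf ⊢
  intro w hw
  have := hf (Finsupp.single k M + w) (by
    rw [mem_support_iff, X_pow_eq_monomial, coeff_monomial_mul, one_mul]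
    exact mem_support_iff.mp hw)
  simpa [Finsupp.single_apply, hik.symm, hjk.symm] using this

/-- A polynomial `X k ^ M` plus a nilpotent is regular modulo `(X i ^ A, X j ^ B)`. -/
theorem mem_span_X_pow_pair_of_mul_mem {i j k : σ} (hik : i ≠ k) (hjk : j ≠ k) {A B M N : ℕ}
    {P h : MvPolynomial σ K} (hP : P = X k ^ M + h) (hh : h ^ N ∈ Ideal.span {X i ^ A, X j ^ B})
    (f : MvPolynomial σ K) (hf : P * f ∈ Ideal.span {X i ^ A, X j ^ B}) :
    f ∈ Ideal.span {X i ^ A, X j ^ B} := by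
  apply mem_span_X_pow_pair_of_X_pow_mul_mem hik hjk (M := M * N)
  -- P divides X_k^(MN) - (-h)^N and h^N is in the ideal, so a power of X_k multiplies f into it.
  obtain ⟨Q, hQ⟩ := sub_dvd_pow_sub_pow (X k ^ M) (-h) N
  have h1 : X k ^ (M * N) * f = Q * (P * f) + (-1) ^ N * f * h ^ N := by
    rw [pow_mul, hP, mul_right_comm, ← neg_pow]
    linear_combination f * hQ
  rw [h1]
  exact add_mem (Ideal.mul_mem_left _ _ hf) (Ideal.mul_mem_left _ _ hh)

theorem X_pow_dvd_of_dvd_X_pow_mul {i j : σ} (hij : i ≠ j) (A B : ℕ) (f : MvPolynomial σ K)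
    (hf : X i ^ A ∣ X j ^ B * f) : X i ^ A ∣ f := by
  refine (X_prime (i := i)).pow_dvd_of_dvd_mul_left A (fun h => hij ?_) hf
  have := (X_prime (i := i)).dvd_of_dvd_pow h
  rwa [X_dvd_X] at this

theorem isCompleteIntersection_of_triple {F p q r : MvPolynomial σ K} (hF : F ≠ 0)
    (hI : ∀ f, f ∈ Ann F ↔ f ∈ Ideal.span {p, q, r}) (hp : p ≠ 0)
    (hq : ∀ f, p ∣ q * f → p ∣ f)
    (hr : ∀ f, r * f ∈ Ideal.span {p, q} → f ∈ Ideal.span {p, q}) :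
    IsCompleteIntersection F := by
  have hS : Ideal.ofList [p, q, r] = Ideal.span {p, q, r} := by
    rw [Ideal.ofList]; congr 1; ext; simp
  have hS2 : Ideal.ofList [p, q] = Ideal.span {p, q} := by
    rw [Ideal.ofList]; congr 1; ext; simp
  have hA : Ideal.ofList [p, q, r] = Ann F := by
    ext f; rw [hI, hS]
  refine ⟨[p, q, r], ⟨⟨?_⟩, ?_⟩, hA⟩
  · intro l hl
    rw [isSMulRegular_quotient_iff_mem_of_smul_mem]
    simp only [smul_eq_mul, Ideal.mul_top]
    match l, hl with
    | 0, _ => simp [hp]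
    | 1, _ => simpa [Ideal.mem_span_singleton] using hq
    | 2, _ => simpa [hS2] using hr
  · rw [smul_eq_mul, Ideal.mul_top, hA]
    intro h
    have h1 : (1 : MvPolynomial σ K) ∈ Ann F := h ▸ Submodule.mem_top
    rw [mem_Ann, contract_one_left] at h1
    exact hF h1

/-! ### The annihilator as a colon ideal, and the complete intersection cases -/

theorem mem_Ann_binomial {i j k : Fin 3} (hij : i ≠ j) (hik : i ≠ k) (hjk : j ≠ k)
    (a b c e m n : ℕ) (f : MvPolynomial (Fin 3) K) :
    f ∈ Ann (X i ^ a * X j ^ b * X k ^ c * (X k ^ n - X i ^ e * X j ^ m)) ↔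
      (X k ^ n - X i ^ e * X j ^ m) * f ∈
        Ideal.span {X i ^ (a + e + 1), X j ^ (b + m + 1), X k ^ (c + n + 1)} := by
  have hcov (l : Fin 3) : l = i ∨ l = j ∨ l = k := by omega
  set G : MvPolynomial (Fin 3) K := X i ^ (a + e) * X j ^ (b + m) * X k ^ (c + n) with hG
  have hG' : G = monomial (Finsupp.single i (a + e) + Finsupp.single j (b + m) +
      Finsupp.single k (c + n)) 1 := by
    simp [hG, X_pow_eq_monomial, monomial_mul]
  have h1 : contract (X k ^ n - X i ^ e * X j ^ m) G =
      -(X i ^ a * X j ^ b * X k ^ c * (X k ^ n - X i ^ e * X j ^ m)) := by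
    have e1 : contract (X k ^ n) G = X i ^ (a + e) * X j ^ (b + m) * X k ^ c := by
      rw [show G = X k ^ n * (X i ^ (a + e) * X j ^ (b + m) * X k ^ c) by rw [hG]; ring,
        X_pow_eq_monomial, contract_monomial_mul]
    have e2 : contract (X i ^ e * X j ^ m) G = X i ^ a * X j ^ b * X k ^ (c + n) := by
      rw [show G = (X i ^ e * X j ^ m) * (X i ^ a * X j ^ b * X k ^ (c + n)) by rw [hG]; ring,
        show (X i ^ e * X j ^ m : MvPolynomial (Fin 3) K) =
          monomial (Finsupp.single i e + Finsupp.single j m) 1 by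
          simp [X_pow_eq_monomial, monomial_mul], contract_monomial_mul]
    rw [contract_sub_left, e1, e2]
    ring
  rw [← Ann_neg, ← h1, mem_Ann_contract, hG', mem_Ann_monomial, mem_span_X_pow_triple]
  refine forall₂_congr fun w _ => ?_
  have hle : w ≤ Finsupp.single i (a + e) + Finsupp.single j (b + m) + Finsupp.single k (c + n) ↔
      w i ≤ a + e ∧ w j ≤ b + m ∧ w k ≤ c + n := by
    constructor
    · intro h
      have hi := h i
      have hj := h j
      have hk := h k
      simp [hij, hik, hjk, hij.symm, hik.symm, hjk.symm] at hi hj hk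
      exact ⟨hi, hj, hk⟩
    · rintro ⟨hi, hj, hk⟩ l
      rcases hcov l with rfl | rfl | rfl <;>
        simp [hij, hik, hjk, hij.symm, hik.symm, hjk.symm, hi, hj, hk]
  rw [hle]
  omega

/-- Since (q+1)e ≥ a+e+1, z^(c+n+1) ≡ (t - s) z^r g_q mod x^(a+e+1), where r = c+1-qn. Cancelling t
- s gives Ann(F) = (x^(a+e+1), y^(b+m+1), z^r g_q). Only qn ≤ c+1 is needed, so the lemma also
serves other values of q. -/
theorem isCompleteIntersection_binomial_of_lt {i j k : Fin 3} (hij : i ≠ j) (hik : i ≠ k)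
    (hjk : j ≠ k) {a b c e m n q : ℕ} (hq : q * n ≤ c + 1) (ha : a < q * e)
    (hF : (X i ^ a * X j ^ b * X k ^ c * (X k ^ n - X i ^ e * X j ^ m) :
      MvPolynomial (Fin 3) K) ≠ 0) :
    IsCompleteIntersection
      (X i ^ a * X j ^ b * X k ^ c * (X k ^ n - X i ^ e * X j ^ m) : MvPolynomial (Fin 3) K) := by
  obtain ⟨r, hr⟩ := Nat.exists_eq_add_of_le hq
  obtain ⟨p, rfl⟩ : ∃ p, q = p + 1 := Nat.exists_eq_succ_of_ne_zero (by rintro rfl; simp at ha)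
  obtain ⟨d, rfl⟩ : ∃ d, e = d + 1 := Nat.exists_eq_succ_of_ne_zero (by rintro rfl; simp at ha)
  obtain ⟨v, hv⟩ : ∃ v, (p + 2) * (d + 1) = a + (d + 1) + 1 + v :=
    Nat.exists_eq_add_of_le (by linarith [ha])
  set s : MvPolynomial (Fin 3) K := X i ^ (d + 1) * X j ^ m with hs
  set t : MvPolynomial (Fin 3) K := X k ^ n with ht
  set g := ∑ l ∈ Finset.range (p + 2), t ^ l * s ^ (p + 1 - l) with hg
  have hg1 : (t - s) * g = t ^ (p + 2) - s ^ (p + 2) := mul_geom_sum₂_succ s t (p + 1)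
  have hsp : s ^ (p + 2) = X i ^ (a + (d + 1) + 1) * (X i ^ v * X j ^ (m * (p + 2))) := by
    rw [hs, mul_pow, ← pow_mul, ← pow_mul, mul_comm (d + 1), hv]
    ring
  have hgen : (t - s) * (X k ^ r * g) =
      X k ^ (c + n + 1) - X k ^ r * s ^ (p + 2) := by
    rw [mul_left_comm, hg1, show c + n + 1 = r + n * (p + 2) by linarith, ht]
    ring
  have hPi : X k ^ r * g = X k ^ (c + 1) +
      X i * (X i ^ d * X j ^ m * X k ^ r * ∑ l ∈ Finset.range (p + 1), t ^ l * s ^ (p - l)) := by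
    rw [hg, geom_sum₂_succ, hr, hs, ht]
    ring
  have hmul (M N A B : ℕ) : ∀ f : MvPolynomial (Fin 3) K,
      X k ^ M * f ∈ Ideal.span {X i ^ A, X j ^ B} → f ∈ Ideal.span {X i ^ A, X j ^ B} :=
    fun f => mem_span_X_pow_pair_of_X_pow_mul_mem hik hjk f
  refine isCompleteIntersection_of_triple (p := X i ^ (a + (d + 1) + 1)) (q := X j ^ (b + m + 1))
    (r := X k ^ r * g) hF (fun f => ?_) (pow_ne_zero _ (X_ne_zero _))
    (fun f => X_pow_dvd_of_dvd_X_pow_mul hij _ _ f) ?_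
  · rw [mem_Ann_binomial hij hik hjk]
    constructor
    · intro h
      refine Ideal.mem_span_triple_of_mul_mem (u := t - s) (fun f => ?_) f ?_
      · refine mem_span_X_pow_pair_of_mul_mem hik hjk (M := n) (N := p + 2) (h := -s)
          (by rw [ht]; ring) ?_ f
        rw [neg_pow, hsp]
        exact Ideal.mem_span_pair.mpr ⟨(-1) ^ (p + 2) * (X i ^ v * X j ^ (m * (p + 2))), 0, by ring⟩
      · obtain ⟨α, β, γ, h'⟩ := Submodule.mem_span_triple.mp h
        refine Submodule.mem_span_triple.mpr
          ⟨α + γ * X k ^ r * (X i ^ v * X j ^ (m * (p + 2))), β, γ, ?_⟩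
        simp only [smul_eq_mul] at h' ⊢
        linear_combination h' + γ * hgen - γ * X k ^ r * hsp
    · intro h
      obtain ⟨α, β, γ, h'⟩ := Submodule.mem_span_triple.mp h
      refine Submodule.mem_span_triple.mpr
        ⟨(t - s) * α - γ * X k ^ r * (X i ^ v * X j ^ (m * (p + 2))), (t - s) * β, γ, ?_⟩
      simp only [smul_eq_mul] at h' ⊢
      linear_combination (t - s) * h' - γ * hgen + γ * X k ^ r * hsp
  · refine fun f => mem_span_X_pow_pair_of_mul_mem hik hjk (N := a + (d + 1) + 1) hPi ?_ f
    rw [mul_pow]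
    exact Ideal.mul_mem_right _ _ (Ideal.subset_span (by simp))

theorem X_pow_dvd_of_dvd_mul {i j k : Fin 3} (hik : i ≠ k) (hjk : j ≠ k) {A M : ℕ}
    {P h : MvPolynomial (Fin 3) K} (hP : P = X k ^ M + X j * h)
    (f : MvPolynomial (Fin 3) K) (hf : X i ^ A ∣ P * f) : X i ^ A ∣ f := by
  refine (X_prime (i := i)).pow_dvd_of_dvd_mul_left A (fun ⟨Q, hQ⟩ => ?_) hf
  -- At the point with X_k = 1 and the other variables 0, P is 1 while X_i is 0.
  have := congrArg (eval (Pi.single k (1 : K))) (hP.symm.trans hQ)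
  simp [hik, hjk] at this

theorem mem_span_pair_of_X_pow_mul_mem {i j k : Fin 3} (hij : i ≠ j) (hik : i ≠ k)
    (hjk : j ≠ k) {A B M : ℕ} {P h : MvPolynomial (Fin 3) K} (hP : P = X k ^ M + X j * h)
    (f : MvPolynomial (Fin 3) K) (hf : X j ^ B * f ∈ Ideal.span {X i ^ A, P}) :
    f ∈ Ideal.span {X i ^ A, P} := by
  refine Ideal.mem_span_pair_of_mul_mem_of_swap (u := X j ^ B)
    (fun f => X_pow_dvd_of_dvd_X_pow_mul hij _ _ f) ?_ f hf
  refine fun f => mem_span_X_pow_pair_of_mul_mem hik hjk (N := B) hP ?_ f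
  rw [mul_pow]
  exact Ideal.mul_mem_right _ _ (Ideal.subset_span (by simp))

/-- Here Ann(F) = (x^(a+1), g_(q+1), y^β z^γ g_q) with β = b+1-qn and γ = c+1-qn. Multiplied by t -
s, the last two generators land in (y^(b+n+1), z^(c+n+1)). -/
theorem isCompleteIntersection_binomial_of_mem_Ico {i j k : Fin 3} (hij : i ≠ j) (hik : i ≠ k)
    (hjk : j ≠ k) {a b c n q : ℕ} (hn : 0 < n) (hb : q * n ≤ b) (hb' : b + 1 < (q + 1) * n)
    (hc : q * n ≤ c) (hc' : c + 1 < (q + 1) * n)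
    (hF : (X i ^ a * X j ^ b * X k ^ c * (X k ^ n - X i ^ 0 * X j ^ n) :
      MvPolynomial (Fin 3) K) ≠ 0) :
    IsCompleteIntersection
      (X i ^ a * X j ^ b * X k ^ c * (X k ^ n - X i ^ 0 * X j ^ n) : MvPolynomial (Fin 3) K) := by
  obtain ⟨d, rfl⟩ := Nat.exists_eq_succ_of_ne_zero hn.ne'
  obtain ⟨β, hβ⟩ := Nat.exists_eq_add_of_le (hb.trans b.le_succ)
  obtain ⟨γ, hγ⟩ := Nat.exists_eq_add_of_le (hc.trans c.le_succ)
  obtain ⟨β', hβ'⟩ : ∃ x, (q + 2) * (d + 1) = b + (d + 1) + 1 + x :=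
    Nat.exists_eq_add_of_le (by linarith [hb'])
  obtain ⟨γ', hγ'⟩ : ∃ x, (q + 2) * (d + 1) = c + (d + 1) + 1 + x :=
    Nat.exists_eq_add_of_le (by linarith [hc'])
  set s : MvPolynomial (Fin 3) K := X j ^ (d + 1) with hs
  set t : MvPolynomial (Fin 3) K := X k ^ (d + 1) with ht
  set g := ∑ l ∈ Finset.range (q + 1), t ^ l * s ^ (q - l) with hg
  set g' := ∑ l ∈ Finset.range (q + 2), t ^ l * s ^ (q + 1 - l) with hg'
  have hg1 : (t - s) * g = t ^ (q + 1) - s ^ (q + 1) := mul_geom_sum₂_succ s t q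
  have hg1' : (t - s) * g' = t ^ (q + 2) - s ^ (q + 2) := mul_geom_sum₂_succ s t (q + 1)
  have hgt : g' = t ^ (q + 1) + s * g := geom_sum₂_succ s t q
  have hgs : g' = s ^ (q + 1) + t * g := by
    rw [hg', geom_sum₂_symm, geom_sum₂_succ, ← geom_sum₂_symm]
  have hsN : s ^ (q + 2) = X j ^ (b + (d + 1) + 1) * X j ^ β' := by
    rw [hs, ← pow_mul, mul_comm (d + 1), hβ', pow_add]
  have htN : t ^ (q + 2) = X k ^ (c + (d + 1) + 1) * X k ^ γ' := by
    rw [ht, ← pow_mul, mul_comm (d + 1), hγ', pow_add]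
  have hsB : s ^ (q + 1) * X j ^ β = X j ^ (b + (d + 1) + 1) := by
    rw [hs, ← pow_mul, ← pow_add, show (d + 1) * (q + 1) + β = b + (d + 1) + 1 by linarith]
  have htC : t ^ (q + 1) * X k ^ γ = X k ^ (c + (d + 1) + 1) := by
    rw [ht, ← pow_mul, ← pow_add, show (d + 1) * (q + 1) + γ = c + (d + 1) + 1 by linarith]
  have hjg : ∀ B f, X j ^ B * f ∈ Ideal.span {X i ^ (a + 1), g'} →
      f ∈ Ideal.span {X i ^ (a + 1), g'} := fun B f =>
    mem_span_pair_of_X_pow_mul_mem hij hik hjk (M := (d + 1) * (q + 1)) (h := X j ^ d * g)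
      (by rw [hgt, hs, ht]; ring) f
  have hkg : ∀ B f, X k ^ B * f ∈ Ideal.span {X i ^ (a + 1), g'} →
      f ∈ Ideal.span {X i ^ (a + 1), g'} := fun B f =>
    mem_span_pair_of_X_pow_mul_mem hik hij hjk.symm (M := (d + 1) * (q + 1)) (h := X k ^ d * g)
      (by rw [hgs, hs, ht]; ring) f
  have hjt : ∀ B f, X j ^ B * f ∈ Ideal.span {X i ^ (a + 1), t - s} →
      f ∈ Ideal.span {X i ^ (a + 1), t - s} := fun B f =>
    mem_span_pair_of_X_pow_mul_mem hij hik hjk (M := d + 1) (h := - X j ^ d)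
      (by rw [hs, ht]; ring) f
  have hkt : ∀ B f, X k ^ B * f ∈ Ideal.span {X i ^ (a + 1), t - s} →
      f ∈ Ideal.span {X i ^ (a + 1), t - s} := fun B f => by
    have := mem_span_pair_of_X_pow_mul_mem hik hij hjk.symm (A := a + 1) (B := B) (M := d + 1)
      (P := s - t) (h := - X k ^ d) (by rw [hs, ht]; ring) f
    rwa [← neg_sub, Ideal.span_pair_neg] at this
  have hpt : ∀ f, X i ^ (a + 1) ∣ (t - s) * f → X i ^ (a + 1) ∣ f :=
    fun f => X_pow_dvd_of_dvd_mul hik hjk (M := d + 1) (h := - X j ^ d) (by rw [hs, ht]; ring) f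
  have hpg : ∀ f, X i ^ (a + 1) ∣ g' * f → X i ^ (a + 1) ∣ f :=
    fun f => X_pow_dvd_of_dvd_mul hik hjk (M := (d + 1) * (q + 1)) (h := X j ^ d * g)
      (by rw [hgt, hs, ht]; ring) f
  have hgg : ∀ f, g * f ∈ Ideal.span {X i ^ (a + 1), g'} →
      f ∈ Ideal.span {X i ^ (a + 1), g'} := fun f hf => by
    -- Modulo g', s g ≡ -t^(q+1), so g inherits regularity from a power of z.
    refine hkg ((d + 1) * (q + 1)) f ?_
    obtain ⟨α, β, h⟩ := Ideal.mem_span_pair.mp hf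
    refine Ideal.mem_span_pair.mpr ⟨-s * α, f - s * β, ?_⟩
    rw [pow_mul, ← ht]
    linear_combination (- s) * h + f * hgt
  refine isCompleteIntersection_of_triple (p := X i ^ (a + 1)) (q := g')
    (r := X j ^ β * X k ^ γ * g) hF (fun f => ?_) (pow_ne_zero _ (X_ne_zero _)) hpg
    (fun f hf => hgg f (hkg γ _ (hjg β _ (by simpa only [mul_assoc] using hf))))
  rw [mem_Ann_binomial hij hik hjk, pow_zero, one_mul, add_zero]
  constructor
  · intro h
    obtain ⟨α, β₁, γ₁, h⟩ := Submodule.mem_span_triple.mp h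
    simp only [smul_eq_mul] at h
    -- Multiplying by t^(q+2) ≡ s^(q+2) mod (t - s) g' merges the y- and z-powers into their product
    -- and exposes the factor t - s.
    have h1 : (t - s) * (t ^ (q + 2) * f) ∈ Ideal.span
        {X i ^ (a + 1), X j ^ (b + (d + 1) + 1) * X k ^ (c + (d + 1) + 1), (t - s) * g'} := by
      refine Submodule.mem_span_triple.mpr ⟨t ^ (q + 2) * α, β₁ * X k ^ γ' + γ₁ * X j ^ β',
        γ₁ * X k ^ (c + (d + 1) + 1), ?_⟩
      simp only [smul_eq_mul]
      linear_combination t ^ (q + 2) * h + γ₁ * X k ^ (c + (d + 1) + 1) * (hg1' - hsN)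
        - β₁ * X j ^ (b + (d + 1) + 1) * htN
    have h2 := Ideal.mem_span_triple_of_mul_mem
      (Ideal.mem_span_pair_of_mul_mem_of_swap hpt fun f hf =>
        hkt _ _ (hjt _ _ (by simpa only [mul_assoc] using hf))) _ h1
    -- Modulo g', t^(q+2) ≡ s^(q+2) and s^(q+1) t^(q+1) ≡ -s^(q+2) g, so s^(q+2) can be cancelled.
    refine Ideal.mem_span_triple_of_mul_mem (u := s ^ (q + 2)) (fun f hf => ?_) f ?_
    · rw [hs, ← pow_mul] at hf
      exact hjg _ f hf
    · obtain ⟨α', β₂, γ₂, h3⟩ := Submodule.mem_span_triple.mp h2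
      simp only [smul_eq_mul] at h3
      refine Submodule.mem_span_triple.mpr ⟨α',
        γ₂ - (t - s) * f + β₂ * X j ^ β * X k ^ γ * s ^ (q + 1), - β₂, ?_⟩
      simp only [smul_eq_mul]
      linear_combination h3 - f * hg1' + β₂ * X j ^ β * X k ^ γ * s ^ (q + 1) * hgt
        + β₂ * X k ^ γ * t ^ (q + 1) * hsB + β₂ * X j ^ (b + (d + 1) + 1) * htC
  · intro h
    obtain ⟨α, β₁, γ₁, h⟩ := Submodule.mem_span_triple.mp h
    simp only [smul_eq_mul] at h
    refine Submodule.mem_span_triple.mpr ⟨(t - s) * α,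
      - β₁ * X j ^ β' - γ₁ * X k ^ γ, β₁ * X k ^ γ' + γ₁ * X j ^ β, ?_⟩
    simp only [smul_eq_mul]
    linear_combination (t - s) * h - β₁ * hg1' - γ₁ * X j ^ β * X k ^ γ * hg1 - β₁ * htN + β₁ * hsN
      - γ₁ * X j ^ β * htC + γ₁ * X k ^ γ * hsB

/-- Up to sign, F is symmetric under exchanging (y, b) with (z, c). Unless b and c lie in the same
block [Qn, (Q+1)n - 2], with Q = ⌊b/n⌋, the cancellation of `isCompleteIntersection_binomial_of_lt`
applies in one of the two orders. -/
theorem isCompleteIntersection_binomial_of_exponent_zero {i j k : Fin 3} (hij : i ≠ j)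
    (hik : i ≠ k) (hjk : j ≠ k) {a b c n : ℕ} (hn : 0 < n)
    (hF : (X i ^ a * X j ^ b * X k ^ c * (X k ^ n - X i ^ 0 * X j ^ n) :
      MvPolynomial (Fin 3) K) ≠ 0) :
    IsCompleteIntersection
      (X i ^ a * X j ^ b * X k ^ c * (X k ^ n - X i ^ 0 * X j ^ n) : MvPolynomial (Fin 3) K) := by
  have hQ : b / n * n ≤ b := Nat.div_mul_le_self b n
  have hQ' : b < (b / n + 1) * n := by
    rw [mul_comm]; exact Nat.lt_mul_div_succ b hn
  by_cases h1 : (b / n + 1) * n ≤ c + 1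
  · have e : (X i ^ a * X j ^ b * X k ^ c * (X k ^ n - X i ^ 0 * X j ^ n) :
        MvPolynomial (Fin 3) K) =
        X j ^ b * X i ^ a * X k ^ c * (X k ^ n - X j ^ n * X i ^ 0) := by ring
    rw [e] at hF ⊢
    exact isCompleteIntersection_binomial_of_lt hij.symm hjk hik h1 hQ' hF
  have hswap : (X i ^ a * X j ^ b * X k ^ c * (X k ^ n - X i ^ 0 * X j ^ n) :
      MvPolynomial (Fin 3) K) =
      -(X k ^ c * X i ^ a * X j ^ b * (X j ^ n - X k ^ n * X i ^ 0)) := by ring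
  by_cases h2 : c < b / n * n
  · rw [hswap, neg_ne_zero] at hF
    rw [hswap, isCompleteIntersection_neg]
    exact isCompleteIntersection_binomial_of_lt hik.symm hjk.symm hij (hQ.trans b.le_succ) h2 hF
  by_cases h3 : b + 1 = (b / n + 1) * n
  · rw [hswap, neg_ne_zero] at hF
    rw [hswap, isCompleteIntersection_neg]
    exact isCompleteIntersection_binomial_of_lt hik.symm hjk.symm hij h3.ge (by omega) hF
  · exact isCompleteIntersection_binomial_of_mem_Ico hij hik hjk hn hQ (by omega) (by omega)
      (by omega) hF

/-! ### Failure of the complete intersection property -/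

/-- A complete intersection ideal in three variables does not have four minimal generators. -/
theorem not_isCompleteIntersection_of_coeff {F : MvPolynomial (Fin 3) K}
    (p : Fin 4 → Fin 3 →₀ ℕ)
    (hp : ∀ l, ∀ f ∈ Ann F, ∀ w ≤ p l, w ≠ p l → coeff w f = 0)
    (h : Fin 4 → MvPolynomial (Fin 3) K) (hh : ∀ l, h l ∈ Ann F)
    (hind : LinearIndependent K fun l l' => coeff (p l') (h l)) :
    ¬ IsCompleteIntersection F := by
  classical
  rintro ⟨rs, hreg, hrs⟩
  have hlen : rs.length ≤ 3 := by
    have := hreg.length_le_ringKrullDim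
    rw [MvPolynomial.ringKrullDim_of_isNoetherianRing, ringKrullDim_eq_zero_of_field] at this
    simpa using this
  let Φ : MvPolynomial (Fin 3) K →ₗ[K] Fin 4 → K := LinearMap.pi fun l => lcoeff K (p l)
  have hΦ (f : MvPolynomial (Fin 3) K) (l) : Φ f l = coeff (p l) f := rfl
  -- Elements of Ann(F) vanish strictly below each `p l`, so only the constant term of g
  -- contributes. Hence Φ maps Ann(F) into the span of the images of any generators.
  have hmul (g f : MvPolynomial (Fin 3) K) (hf : f ∈ Ann F) : Φ (g * f) = coeff 0 g • Φ f := by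
    ext l
    rw [Pi.smul_apply, hΦ, hΦ, coeff_mul, Finset.sum_eq_single (0, p l)]
    · rfl
    · rintro ⟨u, w⟩ hu hne
      rw [Finset.HasAntidiagonal.mem_antidiagonal] at hu
      simp only at hu
      rw [hp l f hf w (hu ▸ le_add_self), mul_zero]
      rintro rfl
      exact hne (by simpa using hu)
    · intro h; simp at h
  let V : Submodule K (Fin 4 → K) := Submodule.span K (rs.toFinset.image Φ)
  have hV : ∀ f ∈ Ann F, Φ f ∈ V := by
    intro f hf
    rw [← hrs] at hf
    have hmem : ∀ x ∈ Ideal.ofList rs, x ∈ Ann F := hrs.le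
    induction hf using Submodule.span_induction with
    | mem x hx => exact Submodule.subset_span (by simpa using ⟨x, hx, rfl⟩)
    | zero => rw [map_zero]; exact zero_mem _
    | add x y _ _ hx hy => rw [map_add]; exact add_mem hx hy
    | smul g x hx ih => rw [smul_eq_mul, hmul _ _ (hmem _ hx)]; exact V.smul_mem _ ih
  have h1 : Submodule.span K (Set.range fun l l' => coeff (p l') (h l)) ≤ V := by
    rw [Submodule.span_le]
    rintro _ ⟨l, rfl⟩
    exact hV _ (hh l)
  have h2 := Submodule.finrank_mono h1
  rw [finrank_span_eq_card hind, Fintype.card_fin] at h2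
  have h3 : Module.finrank K V ≤ (rs.toFinset.image Φ).card := finrank_span_finset_le_card _
  have h4 := (Finset.card_image_le (s := rs.toFinset) (f := Φ)).trans (rs.toFinset_card_le)
  omega

/-- The exponent vector of `x ^ u * y ^ v * z ^ w`. -/
noncomputable def exponent (u v w : ℕ) : Fin 3 →₀ ℕ :=
  Finsupp.single 0 u + Finsupp.single 1 v + Finsupp.single 2 w

@[simp] theorem exponent_zero (u v w : ℕ) : exponent u v w 0 = u := by simp [exponent]
@[simp] theorem exponent_one (u v w : ℕ) : exponent u v w 1 = v := by simp [exponent]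
@[simp] theorem exponent_two (u v w : ℕ) : exponent u v w 2 = w := by simp [exponent]

theorem exponent_eta (p : Fin 3 →₀ ℕ) : exponent (p 0) (p 1) (p 2) = p := by
  ext l; fin_cases l <;> simp

theorem X_pow_mul_eq_monomial_exponent (u v w : ℕ) :
    (X 0 ^ u * X 1 ^ v * X 2 ^ w : MvPolynomial (Fin 3) K) = monomial (exponent u v w) 1 := by
  simp [exponent, X_pow_eq_monomial, monomial_mul]

theorem exponent_le {u v w u' v' w' : ℕ} :
    exponent u v w ≤ exponent u' v' w' ↔ u ≤ u' ∧ v ≤ v' ∧ w ≤ w' := by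
  constructor
  · intro h
    exact ⟨by simpa using h 0, by simpa using h 1, by simpa using h 2⟩
  · rintro ⟨h0, h1, h2⟩ l
    fin_cases l <;> simpa

theorem exponent_inj {u v w u' v' w' : ℕ} :
    exponent u v w = exponent u' v' w' ↔ u = u' ∧ v = v' ∧ w = w' := by
  rw [le_antisymm_iff, exponent_le, exponent_le]
  omega

theorem coeff_exponent_X_pow_mul (u v w u' v' w' : ℕ) (f : MvPolynomial (Fin 3) K) :
    coeff (exponent u v w) (X 0 ^ u' * X 1 ^ v' * X 2 ^ w' * f) =
      if u' ≤ u ∧ v' ≤ v ∧ w' ≤ w then coeff (exponent (u - u') (v - v') (w - w')) f else 0 := by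
  rw [X_pow_mul_eq_monomial_exponent, coeff_monomial_mul', one_mul]
  simp only [exponent_le]
  congr 2
  ext l
  fin_cases l <;> simp

theorem coeff_exponent_X_pow (u v w u' v' w' : ℕ) :
    coeff (exponent u v w) (X 0 ^ u' * X 1 ^ v' * X 2 ^ w' : MvPolynomial (Fin 3) K) =
      if u' = u ∧ v' = v ∧ w' = w then 1 else 0 := by
  classical
  rw [X_pow_mul_eq_monomial_exponent, coeff_monomial]
  simp only [exponent_inj]

section

variable {a b c e m n : ℕ} {f : MvPolynomial (Fin 3) K}

/-- Inside the box, t f and s f have equal coefficients, by the colon description. -/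
theorem coeff_eq_of_mem_Ann
    (hf : f ∈ Ann (X 0 ^ a * X 1 ^ b * X 2 ^ c * (X 2 ^ n - X 0 ^ e * X 1 ^ m)))
    {u v w : ℕ} (hu : u ≤ a + e) (hv : v ≤ b + m) (hw : w ≤ c + n) :
    (if n ≤ w then coeff (exponent u v (w - n)) f else 0) =
      if e ≤ u ∧ m ≤ v then coeff (exponent (u - e) (v - m) w) f else 0 := by
  rw [mem_Ann_binomial (by decide) (by decide) (by decide), mem_span_X_pow_triple] at hf
  have h := mt (hf (exponent u v w)) (by simp; omega)
  rw [notMem_support_iff, sub_mul, coeff_sub, sub_eq_zero] at h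
  have h1 := coeff_exponent_X_pow_mul u v w 0 0 n f
  have h2 := coeff_exponent_X_pow_mul u v w e m 0 f
  simp only [pow_zero, one_mul, mul_one, Nat.zero_le, true_and, and_true, Nat.sub_zero] at h1 h2
  rw [← h1, ← h2, h]

theorem coeff_eq_zero_of_mem_Ann
    (hf : f ∈ Ann (X 0 ^ a * X 1 ^ b * X 2 ^ c * (X 2 ^ n - X 0 ^ e * X 1 ^ m)))
    {u v w : ℕ} (hu : u ≤ a + e) (hv : v ≤ b + m) (hw : w ≤ c) (h : u < e ∨ v < m) :
    coeff (exponent u v w) f = 0 := by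
  have := coeff_eq_of_mem_Ann hf hu hv (Nat.add_le_add_right hw n)
  rwa [if_pos (by omega), if_neg (by omega), Nat.add_sub_cancel] at this

/-- The coefficients at (u + le, lm, c+1-ln), 0 ≤ l ≤ q, all agree. The chain ends in 0 because
c+1-qn < n; u + qe ≤ a and qm ≤ b keep it inside the box. -/
theorem coeff_corner_eq_zero_of_mem_Ann {q : ℕ} (hq : q * n ≤ c + 1) (hq' : c + 1 < (q + 1) * n)
    (hb : q * m ≤ b)
    (hf : f ∈ Ann (X 0 ^ a * X 1 ^ b * X 2 ^ c * (X 2 ^ n - X 0 ^ e * X 1 ^ m)))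
    {u : ℕ} (hu : u + q * e ≤ a) : coeff (exponent u 0 (c + 1)) f = 0 := by
  have h0 : 0 < n := Nat.pos_of_ne_zero (by rintro rfl; simp at hq')
  have key : ∀ d ≤ q, ∀ l, l + d = q →
      coeff (exponent (u + l * e) (l * m) (c + 1 - l * n)) f = 0 := by
    intro d
    induction d with
    | zero =>
      rintro - l hl
      obtain rfl : l = q := by omega
      rw [add_mul, one_mul] at hq'
      have := coeff_eq_of_mem_Ann hf (u := u + l * e + e) (v := l * m + m) (w := c + 1 - l * n)
        (by omega) (by omega) (by omega)
      rw [if_neg (by omega), if_pos (by omega)] at this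
      simpa using this.symm
    | succ d ih =>
      intro hd l hl
      have h1 := ih (by omega) (l + 1) (by omega)
      have he : (l + 1) * e ≤ q * e := Nat.mul_le_mul_right _ (by omega)
      have hm : (l + 1) * m ≤ q * m := Nat.mul_le_mul_right _ (by omega)
      have hn : (l + 1) * n ≤ q * n := Nat.mul_le_mul_right _ (by omega)
      rw [add_mul, one_mul] at he hm hn
      have := coeff_eq_of_mem_Ann hf (u := u + l * e + e) (v := l * m + m) (w := c + 1 - l * n)
        (by omega) (by omega) (by omega)
      rw [if_pos (by omega), if_pos (by omega)] at this
      rw [add_mul, add_mul, add_mul, one_mul, one_mul, one_mul, ← add_assoc,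
        Nat.sub_add_eq] at h1
      rw [h1] at this
      simpa using this.symm
  simpa using key q le_rfl 0 (by omega)

end

theorem not_isCompleteIntersection_binomial {a b c e m n q : ℕ} (he : 0 < e) (hm : 0 < m)
    (hq : q * n ≤ c + 1) (hq' : c + 1 < (q + 1) * n) (ha : q * e ≤ a) (hb : q * m ≤ b) :
    ¬ IsCompleteIntersection (X 0 ^ a * X 1 ^ b * X 2 ^ c * (X 2 ^ n - X 0 ^ e * X 1 ^ m) :
      MvPolynomial (Fin 3) K) := by
  classical
  set F : MvPolynomial (Fin 3) K :=
    X 0 ^ a * X 1 ^ b * X 2 ^ c * (X 2 ^ n - X 0 ^ e * X 1 ^ m) with hF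
  have hmem : ∀ f, f ∈ Ann F ↔ _ := mem_Ann_binomial (K := K) (i := 0) (j := 1) (k := 2)
    (by decide) (by decide) (by decide) a b c e m n
  obtain ⟨r, hr⟩ := Nat.exists_eq_add_of_le hq
  obtain ⟨d, hd⟩ := Nat.exists_eq_add_of_le ha
  set s : MvPolynomial (Fin 3) K := X 0 ^ e * X 1 ^ m with hs
  set t : MvPolynomial (Fin 3) K := X 2 ^ n with ht
  set g := ∑ l ∈ Finset.range (q + 1), t ^ l * s ^ (q - l) with hg
  have hg1 : (t - s) * g = t ^ (q + 1) - s ^ (q + 1) := mul_geom_sum₂_succ s t q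
  have hgt : ∃ h, g = t ^ q + s * h := by
    obtain - | q := q
    · exact ⟨0, by simp [hg]⟩
    · exact ⟨_, geom_sum₂_succ s t q⟩
  obtain ⟨h, hgt⟩ := hgt
  set H := X 0 ^ (d + 1) * X 2 ^ r * g with hH
  have hx : X 0 ^ (a + e + 1) ∈ Ann F :=
    (hmem _).mpr (Ideal.mul_mem_left _ _ (Ideal.subset_span (by simp)))
  have hy : X 1 ^ (b + m + 1) ∈ Ann F :=
    (hmem _).mpr (Ideal.mul_mem_left _ _ (Ideal.subset_span (by simp)))
  have hz : X 2 ^ (c + n + 1) ∈ Ann F :=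
    (hmem _).mpr (Ideal.mul_mem_left _ _ (Ideal.subset_span (by simp)))
  have hHA : H ∈ Ann F := by
    refine (hmem _).mpr (Submodule.mem_span_triple.mpr
      ⟨- (X 2 ^ r * X 1 ^ (m * (q + 1))), 0, X 0 ^ (d + 1), ?_⟩)
    have h1 : X 0 ^ (d + 1) * s ^ (q + 1) = X 0 ^ (a + e + 1) * X 1 ^ (m * (q + 1)) := by
      rw [hs, hd]; ring
    have h2 : X 2 ^ r * t ^ (q + 1) = X 2 ^ (c + n + 1) := by
      rw [ht, show c + n + 1 = r + n * (q + 1) by linarith]; ring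
    simp only [smul_eq_mul]
    linear_combination -(X 0 ^ (d + 1) * X 2 ^ r) * hg1 + X 2 ^ r * h1 - X 0 ^ (d + 1) * h2
  -- Minimality of J gives the vanishing below the fourth exponent without computing J.
  have hex : ∃ J, ∃ f ∈ Ann F, coeff (exponent 0 0 J) f ≠ 0 :=
    ⟨c + n + 1, _, hz, by
      have := coeff_exponent_X_pow (K := K) 0 0 (c + n + 1) 0 0 (c + n + 1)
      simp only [pow_zero, one_mul] at this
      simp [this]⟩
  set J := Nat.find hex with hJ
  obtain ⟨fJ, hfJ, hfJ'⟩ := Nat.find_spec hex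
  rw [← hJ] at hfJ'
  refine not_isCompleteIntersection_of_coeff
    ![exponent (a + e + 1) 0 0, exponent 0 (b + m + 1) 0, exponent (d + 1) 0 (c + 1),
      exponent 0 0 J] ?_ ![X 0 ^ (a + e + 1), X 1 ^ (b + m + 1), H, fJ] ?_ ?_
  · intro l f hf w hw hne
    rw [← exponent_eta w] at hw hne ⊢
    generalize w 0 = u, w 1 = v, w 2 = w at *
    fin_cases l <;> simp [exponent_le, exponent_inj] at hw hne
    · exact coeff_eq_zero_of_mem_Ann hf (by omega) (by omega) (by omega) (by omega)
    · exact coeff_eq_zero_of_mem_Ann hf (by omega) (by omega) (by omega) (by omega)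
    · obtain ⟨hu, rfl, hw⟩ := hw
      by_cases h1 : w ≤ c
      · exact coeff_eq_zero_of_mem_Ann hf (by omega) (by omega) (by omega) (by omega)
      · obtain rfl : w = c + 1 := by omega
        exact coeff_corner_eq_zero_of_mem_Ann hq hq' hb hf (by omega)
    · obtain ⟨rfl, rfl, hw⟩ := hw
      have := Nat.find_min hex (m := w) (by omega)
      push Not at this
      exact this f hf
  · intro l
    fin_cases l
    exacts [hx, hy, hHA, hfJ]
  · have x0 := coeff_exponent_X_pow (K := K) (a + e + 1) 0 0 (a + e + 1) 0 0
    have x2 := coeff_exponent_X_pow (K := K) (d + 1) 0 (c + 1) (a + e + 1) 0 0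
    have x1 := coeff_exponent_X_pow (K := K) 0 (b + m + 1) 0 (a + e + 1) 0 0
    have x3 := coeff_exponent_X_pow (K := K) 0 0 J (a + e + 1) 0 0
    have y0 := coeff_exponent_X_pow (K := K) (a + e + 1) 0 0 0 (b + m + 1) 0
    have y1 := coeff_exponent_X_pow (K := K) 0 (b + m + 1) 0 0 (b + m + 1) 0
    have y2 := coeff_exponent_X_pow (K := K) (d + 1) 0 (c + 1) 0 (b + m + 1) 0
    have y3 := coeff_exponent_X_pow (K := K) 0 0 J 0 (b + m + 1) 0
    simp at x0 x1 x2 x3 y0 y1 y2 y3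
    have H2 : coeff (exponent (d + 1) 0 (c + 1)) H = 1 := by
      -- All other terms of H are divisible by y^m with m > 0.
      have e1 : H = X 0 ^ (d + 1) * X 1 ^ 0 * X 2 ^ (c + 1) +
          X 0 ^ 0 * X 1 ^ m * X 2 ^ 0 * (X 0 ^ (d + 1) * X 2 ^ r * X 0 ^ e * h) := by
        rw [hH, hgt, hr, hs, ht]; ring
      rw [e1, coeff_add, coeff_exponent_X_pow, coeff_exponent_X_pow_mul, if_pos (by simp),
        if_neg (by omega), add_zero]
    have H3 : coeff (exponent 0 0 J) H = 0 := by
      have e1 : H = X 0 ^ (d + 1) * X 1 ^ 0 * X 2 ^ 0 * (X 2 ^ r * g) := by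
        rw [hH]; ring
      rw [e1, coeff_exponent_X_pow_mul, if_neg (by omega)]
    -- The coefficient matrix is triangular: column 3 kills γ 3, then column 2 kills γ 2, then the
    -- rest follow.
    rw [Fintype.linearIndependent_iff]
    intro γ hγ
    have z0 := congrFun hγ 0
    have z1 := congrFun hγ 1
    have z2 := congrFun hγ 2
    have z3 := congrFun hγ 3
    simp [Fin.sum_univ_four, x0, x1, x2, x3, y0, y1, y2, y3, H2, H3, hfJ'] at z0 z1 z2 z3
    simp [z3] at z0 z1 z2
    simp [z2] at z0 z1
    intro l
    fin_cases l
    exacts [z0, z1, z2, z3]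

end MacaulayDuality

/-! ### The equivalence, using the symmetry between x and y -/

open MacaulayDuality in
theorem mainTheorem5 {K : Type*} [Field K] (a b c n e m q : ℕ)
    (hn : n = e + m) (hpos : 0 < n) (hq : q = (c + 1) / n)
    (F : MvPolynomial (Fin 3) K)
    (hF : F = MvPolynomial.X 0 ^ a * MvPolynomial.X 1 ^ b * MvPolynomial.X 2 ^ c *
      (MvPolynomial.X 2 ^ n - MvPolynomial.X 0 ^ e * MvPolynomial.X 1 ^ m)) :
    MacaulayDuality.IsCompleteIntersection F ↔
      (e = 0 ∨ m = 0 ∨ a < q * e ∨ b < q * m) := by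
  have hq1 : q * n ≤ c + 1 := hq ▸ Nat.div_mul_le_self _ _
  have hq2 : c + 1 < (q + 1) * n := by
    rw [hq, mul_comm]; exact Nat.lt_mul_div_succ _ hpos
  have hF0 : F ≠ 0 := by
    rw [hF]
    refine mul_ne_zero (mul_ne_zero (mul_ne_zero ?_ ?_) ?_) fun h => ?_
    · exact pow_ne_zero _ (X_ne_zero _)
    · exact pow_ne_zero _ (X_ne_zero _)
    · exact pow_ne_zero _ (X_ne_zero _)
    -- At (0, 0, 1) the binomial is 1 - 0^(e+m) = 1, since n > 0.
    · have := congrArg (eval (Pi.single 2 (1 : K))) h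
      simp [← pow_add, ← hn, hpos.ne'] at this
  have hsymm : F = X 1 ^ b * X 0 ^ a * X 2 ^ c * (X 2 ^ n - X 1 ^ m * X 0 ^ e) := by
    rw [hF]; ring
  constructor
  · intro h
    by_contra! hne
    obtain ⟨he, hm, ha, hb⟩ := hne
    exact not_isCompleteIntersection_binomial (Nat.pos_of_ne_zero he) (Nat.pos_of_ne_zero hm)
      hq1 hq2 ha hb (hF ▸ h)
  · rintro (rfl | rfl | h | h)
    · obtain rfl : n = m := by omega
      rw [hF] at hF0 ⊢
      exact isCompleteIntersection_binomial_of_exponent_zero (by decide) (by decide) (by decide)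
        hpos hF0
    · obtain rfl : n = e := by omega
      rw [hsymm] at hF0 ⊢
      exact isCompleteIntersection_binomial_of_exponent_zero (by decide) (by decide) (by decide)
        hpos hF0
    · rw [hF] at hF0 ⊢
      exact isCompleteIntersection_binomial_of_lt (by decide) (by decide) (by decide) hq1 h hF0
    · rw [hsymm] at hF0 ⊢
      exact isCompleteIntersection_binomial_of_lt (by decide) (by decide) (by decide) hq1 h hF0
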